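/- There is a recursive bipartite graph $G=(\omega,E)$ on the vertex set $\omega$ such that $$\mu\{X\in 2^{\omega} : X \text{ enumerates an infinite homogeneous set for } G\}=0 .$$ Here $G$ is recursive if its edge relation is a recursive set of pairs; $H\subseteq\omega$ is homogeneous for $G$ if no two vertices of $H$ are connected by a path of odd length in $G$; $X$ enumerates $H$ if $H$ is recursively enumerable in $X$, that is, $H$ is the domain of a partial function recursive in the oracle $X$; and $\mu$ is the uniform (Lebesgue) probability measure on Cantor space $2^{\omega}$, for which the set of all extensions of a finite binary string $\sigma$ has measure $2^{-|\sigma|}$. -/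

import Mathlib

/-- The uniform (fair-coin, Lebesgue) probability measure on Cantor space `2^ω`. -/
noncomputable def cantorMeasure : MeasureTheory.Measure (ℕ → Bool) :=
  MeasureTheory.Measure.infinitePi fun _ : ℕ => (PMF.uniformOfFintype Bool).toMeasure

/-- The oracle `X ∈ 2^ω`, as the characteristic function of the set `{n | X n = true}`. -/
def oracleFun (X : ℕ → Bool) : ℕ →. ℕ := fun n => Part.some (X n).toNat

/-- `X` enumerates `H`: the set `H` is r.e. in `X`, i.e. it is the domain of a partial function
that is recursive in `X`. -/
def Enumerates (X : ℕ → Bool) (H : Set ℕ) : Prop :=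
  ∃ f : ℕ →. ℕ, Nat.RecursiveIn {oracleFun X} f ∧ f.Dom = H

/-- A graph on `ω` is recursive if its edge relation is decidable by an algorithm. -/
def RecursiveGraph (G : SimpleGraph ℕ) : Prop :=
  ComputablePred fun p : ℕ × ℕ => G.Adj p.1 p.2

/-- `H` is homogeneous for `G` if no two vertices of `H` are joined by a path of odd length. -/
def GraphHomogeneous (G : SimpleGraph ℕ) (H : Set ℕ) : Prop :=
  ∀ u ∈ H, ∀ v ∈ H, ¬ ∃ p : G.Walk u v, p.IsPath ∧ Odd p.length

/-! An oracle computation uses only finitely much of `X`, so every set enumerated by `X` is some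
`enumSet e X` with `e` an ordinary program. As there are countably many `e`, it suffices that each
`homogeneousOracles splitGraph e` is null. By a density argument
(`cantorMeasure_eq_zero_of_forall_le`), it is enough that it fills at most two thirds of every
cylinder `σ`.

The graph is built by a finite-injury style construction with one requirement for each pair `(σ,
e)`, coded by `c`. The pair of vertices `2 * s`, `2 * s + 1` starts as a two-coloured component
numbered `s`. At stage `s` one requirement may merge older components into component `s`, reversing
the colours of some. The new vertices are then joined to all vertices of opposite colour there.
Relative colours inside a component never change again, so the graph is bipartite, and its edges are
decided by a bounded run of the construction. A requirement acts at most once and may not touch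
components containing a vertex `≤ c`, so every vertex settles.

Suppose more than two thirds of the extensions of `σ` enumerate an infinite homogeneous set through
`e`. At some finite level, more than two thirds of the strings enumerate a pair in distinct final
components that `c` may touch. A random choice of reversals makes each such pair oppositely coloured
with probability one half, so some choice works for more than a third of the strings
(`exists_flip_split`). Hence the requirement eventually acts (`exists_split_of_request`); its action
joins by odd paths pairs enumerated by at least a third of the extensions, and at most two thirds
remain. -/

/-- The initial segment of length `k` of `X`. -/
def initSeg (X : ℕ → Bool) (k : ℕ) : List Bool := (List.range k).map X

theorem length_initSeg (X : ℕ → Bool) (k : ℕ) : (initSeg X k).length = k := by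
  simp [initSeg]

theorem getElem?_initSeg (X : ℕ → Bool) (k n : ℕ) :
    (initSeg X k)[n]? = if n < k then some (X n) else none := by
  by_cases h : n < k <;> simp [initSeg, h]

theorem take_initSeg (X : ℕ → Bool) {k l : ℕ} (h : k ≤ l) :
    (initSeg X l).take k = initSeg X k := by
  simp [initSeg, ← List.map_take, List.take_range, h]

/-! ### Use principle: oracle computations from finite initial segments. -/

/-- `g` computes better and better approximations of `f` from longer and longer initial segments
of the oracle `X`. -/
structure ApproxAlong (X : ℕ → Bool) (f : ℕ →. ℕ) (g : List Bool → ℕ →. ℕ) : Prop where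
  partrec : Partrec₂ g
  mono : ∀ {k l}, k ≤ l → ∀ {n v}, v ∈ g (initSeg X k) n → v ∈ g (initSeg X l) n
  mem_iff : ∀ n v, v ∈ f n ↔ ∃ k, v ∈ g (initSeg X k) n

namespace ApproxAlong

variable {X : ℕ → Bool} {f h : ℕ →. ℕ} {g j : List Bool → ℕ →. ℕ}

theorem of_partrec (hf : Nat.Partrec f) : ApproxAlong X f fun _ => f where
  partrec := (Partrec.nat_iff.2 hf).comp Computable.snd
  mono _ _ _ hv := hv
  mem_iff _ _ := by simp

theorem oracle : ApproxAlong X (oracleFun X) fun σ n => ((σ[n]?.map Bool.toNat : Option ℕ) : Part ℕ) where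
  partrec := by
    refine Computable.ofOption ?_
    refine (Computable.option_map (Primrec.list_getElem?.comp Primrec.fst Primrec.snd).to_comp ?_)
    exact ((Primrec.dom_finite Bool.toNat).comp Primrec.snd).to_comp.to₂
  mono {k l} hkl n v hv := by
    simp only [getElem?_initSeg, Part.mem_coe, Option.mem_def] at hv ⊢
    split_ifs at hv with h
    · rwa [if_pos (h.trans_le hkl)]
    · simp at hv
  mem_iff n v := by
    simp only [getElem?_initSeg, Part.mem_coe, Option.mem_def, oracleFun, Part.mem_some_iff]
    constructor
    · rintro rfl
      exact ⟨n + 1, by simp⟩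
    · rintro ⟨k, hk⟩
      split_ifs at hk with h
      · simpa using hk.symm
      · simp at hk

theorem pair (hf : ApproxAlong X f g) (hh : ApproxAlong X h j) :
    ApproxAlong X (fun n => Nat.pair <$> f n <*> h n)
      fun σ n => (g σ n).bind fun a => (j σ n).map (Nat.pair a) where
  partrec := by
    refine Partrec.bind hf.partrec (Partrec.map
      (hh.partrec.comp (Computable.fst.comp Computable.fst) (Computable.snd.comp Computable.fst)) ?_)
    exact (Primrec₂.natPair.comp (Primrec.snd.comp Primrec.fst) Primrec.snd).to_comp.to₂
  mono hkl n v hv := by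
    simp only [Part.mem_bind_iff, Part.mem_map_iff] at hv ⊢
    obtain ⟨a, ha, b, hb, rfl⟩ := hv
    exact ⟨a, hf.mono hkl ha, b, hh.mono hkl hb, rfl⟩
  mem_iff n v := by
    simp only [Seq.seq, Part.map_eq_map, Part.mem_bind_iff, Part.mem_map_iff]
    constructor
    · rintro ⟨_, ⟨a, ha, rfl⟩, b, hb, rfl⟩
      obtain ⟨k, hk⟩ := (hf.mem_iff _ _).1 ha
      obtain ⟨l, hl⟩ := (hh.mem_iff _ _).1 hb
      exact ⟨max k l, a, hf.mono (le_max_left _ _) hk, b, hh.mono (le_max_right _ _) hl, rfl⟩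
    · rintro ⟨k, a, ha, b, hb, rfl⟩
      exact ⟨_, ⟨a, (hf.mem_iff _ _).2 ⟨k, ha⟩, rfl⟩, b, (hh.mem_iff _ _).2 ⟨k, hb⟩, rfl⟩

theorem comp (hf : ApproxAlong X f g) (hh : ApproxAlong X h j) :
    ApproxAlong X (fun n => h n >>= f) fun σ n => (j σ n).bind (g σ) where
  partrec := Partrec.bind hh.partrec
    (hf.partrec.comp (Computable.fst.comp Computable.fst) Computable.snd)
  mono hkl n v hv := by
    obtain ⟨a, ha, hb⟩ := Part.mem_bind_iff.1 hv
    exact Part.mem_bind_iff.2 ⟨a, hh.mono hkl ha, hf.mono hkl hb⟩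
  mem_iff n v := by
    refine Part.mem_bind_iff.trans ⟨?_, ?_⟩
    · rintro ⟨a, ha, hb⟩
      obtain ⟨k, hk⟩ := (hh.mem_iff _ _).1 ha
      obtain ⟨l, hl⟩ := (hf.mem_iff _ _).1 hb
      exact ⟨max k l, Part.mem_bind_iff.2
        ⟨a, hh.mono (le_max_left _ _) hk, hf.mono (le_max_right _ _) hl⟩⟩
    · rintro ⟨k, hv⟩
      obtain ⟨a, ha, hb⟩ := Part.mem_bind_iff.1 hv
      exact ⟨a, (hh.mem_iff _ _).2 ⟨k, ha⟩, (hf.mem_iff _ _).2 ⟨k, hb⟩⟩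

/-- Primitive recursion over partial functions, at a fixed parameter. -/
def precAt (f h : ℕ →. ℕ) (a n : ℕ) : Part ℕ :=
  n.rec (f a) fun y IH => IH.bind fun i => h (Nat.pair a (Nat.pair y i))

theorem mem_precAt_succ {f h : ℕ →. ℕ} {a n v : ℕ} : v ∈ precAt f h a (n + 1) ↔
    ∃ i ∈ precAt f h a n, v ∈ h (Nat.pair a (Nat.pair n i)) :=
  Part.mem_bind_iff

theorem prec (hf : ApproxAlong X f g) (hh : ApproxAlong X h j) :
    ApproxAlong X (fun p => precAt f h p.unpair.1 p.unpair.2)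
      fun σ p => precAt (g σ) (j σ) p.unpair.1 p.unpair.2 := by
  have mono : ∀ {k l}, k ≤ l → ∀ {a n v}, v ∈ precAt (g (initSeg X k)) (j (initSeg X k)) a n →
      v ∈ precAt (g (initSeg X l)) (j (initSeg X l)) a n := by
    intro k l hkl a n
    induction n with
    | zero => exact fun hv => hf.mono hkl hv
    | succ n ih =>
      intro v hv
      obtain ⟨i, hi, hv⟩ := mem_precAt_succ.1 hv
      exact mem_precAt_succ.2 ⟨i, ih hi, hh.mono hkl hv⟩
  refine ⟨?_, fun hkl => mono hkl, fun p v => ?_⟩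
  · refine Partrec.nat_rec (f := fun q : List Bool × ℕ => q.2.unpair.2)
      (g := fun q => g q.1 q.2.unpair.1)
      (h := fun q (r : ℕ × ℕ) => j q.1 (Nat.pair q.2.unpair.1 (Nat.pair r.1 r.2))) ?_ ?_ ?_
    · exact (Primrec.snd.comp (Primrec.unpair.comp Primrec.snd)).to_comp
    · exact hf.partrec.comp Computable.fst
        (Primrec.fst.comp (Primrec.unpair.comp Primrec.snd)).to_comp
    · refine hh.partrec.comp (Computable.fst.comp Computable.fst) (Primrec.to_comp ?_)
      exact Primrec₂.natPair.comp
        (Primrec.fst.comp (Primrec.unpair.comp (Primrec.snd.comp Primrec.fst)))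
        (Primrec₂.natPair.comp (Primrec.fst.comp Primrec.snd) (Primrec.snd.comp Primrec.snd))
  · generalize p.unpair.1 = a
    generalize p.unpair.2 = n
    induction n generalizing v with
    | zero => exact hf.mem_iff a v
    | succ n ih =>
      simp only [mem_precAt_succ, ih]
      constructor
      · rintro ⟨i, ⟨k, hk⟩, hv⟩
        obtain ⟨l, hl⟩ := (hh.mem_iff _ _).1 hv
        exact ⟨max k l, i, mono (le_max_left _ _) hk, hh.mono (le_max_right _ _) hl⟩
      · rintro ⟨k, i, hi, hv⟩
        exact ⟨i, ⟨k, hi⟩, (hh.mem_iff _ _).2 ⟨k, hv⟩⟩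

/-- Unbounded search for a zero of a partial function, at a fixed parameter. -/
def rfindAt (f : ℕ →. ℕ) (a : ℕ) : Part ℕ :=
  Nat.rfind fun n => (f (Nat.pair a n)).map fun m => decide (m = 0)

theorem mem_rfindAt {f : ℕ →. ℕ} {a v : ℕ} : v ∈ rfindAt f a ↔
    0 ∈ f (Nat.pair a v) ∧ ∀ i < v, ∃ m ∈ f (Nat.pair a i), m ≠ 0 := by
  refine Nat.mem_rfind.trans (and_congr ?_ (forall₂_congr fun i _ => ?_))
  · refine (Part.mem_map_iff _).trans ⟨?_, fun h => ⟨0, h, rfl⟩⟩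
    rintro ⟨m, hm, h0⟩
    rwa [← of_decide_eq_true h0]
  · refine (Part.mem_map_iff _).trans ?_
    simp

/-- A search that stops at `v` consults only the values at arguments up to `v`, so one long enough
initial segment serves them all. -/
theorem rfind (hf : ApproxAlong X f g) :
    ApproxAlong X (fun a => rfindAt f a) fun σ a => rfindAt (g σ) a where
  partrec := by
    refine Partrec.rfind (p := fun (q : List Bool × ℕ) n =>
      (g q.1 (Nat.pair q.2 n)).map fun m => decide (m = 0)) (Partrec.map ?_ ?_)
    · exact hf.partrec.comp (Computable.fst.comp Computable.fst)
        (Primrec₂.natPair.comp (Primrec.snd.comp Primrec.fst) Primrec.snd).to_comp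
    · exact (PrimrecPred.decide (Primrec.eq.comp Primrec.snd (Primrec.const 0))).to_comp.to₂
  mono hkl n v hv := by
    obtain ⟨h0, hlt⟩ := mem_rfindAt.1 hv
    refine mem_rfindAt.2 ⟨hf.mono hkl h0, fun i hi => ?_⟩
    obtain ⟨m, hm, hne⟩ := hlt i hi
    exact ⟨m, hf.mono hkl hm, hne⟩
  mem_iff n v := by
    simp only [mem_rfindAt]
    constructor
    · rintro ⟨h0, hlt⟩
      obtain ⟨k, hk⟩ := (hf.mem_iff _ _).1 h0
      have : ∀ i, ∃ l, i < v → ∃ m ∈ g (initSeg X l) (Nat.pair n i), m ≠ 0 := by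
        intro i
        by_cases hi : i < v
        · obtain ⟨m, hm, hne⟩ := hlt i hi
          obtain ⟨l, hl⟩ := (hf.mem_iff _ _).1 hm
          exact ⟨l, fun _ => ⟨m, hl, hne⟩⟩
        · exact ⟨0, fun h => absurd h hi⟩
      choose l hl using this
      refine ⟨max k ((Finset.range v).sup l), hf.mono (le_max_left _ _) hk, fun i hi => ?_⟩
      obtain ⟨m, hm, hne⟩ := hl i hi
      exact ⟨m, hf.mono ((Finset.le_sup (Finset.mem_range.2 hi)).trans (le_max_right _ _)) hm, hne⟩
    · rintro ⟨k, h0, hlt⟩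
      refine ⟨(hf.mem_iff _ _).2 ⟨k, h0⟩, fun i hi => ?_⟩
      obtain ⟨m, hm, hne⟩ := hlt i hi
      exact ⟨m, (hf.mem_iff _ _).2 ⟨k, hm⟩, hne⟩

end ApproxAlong

theorem Nat.RecursiveIn.exists_approxAlong {X : ℕ → Bool} {f : ℕ →. ℕ}
    (hf : Nat.RecursiveIn {oracleFun X} f) : ∃ g, ApproxAlong X f g := by
  induction hf with
  | zero => exact ⟨_, .of_partrec .zero⟩
  | succ => exact ⟨_, .of_partrec .succ⟩
  | left => exact ⟨_, .of_partrec .left⟩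
  | right => exact ⟨_, .of_partrec .right⟩
  | oracle g hg => obtain rfl := hg; exact ⟨_, .oracle⟩
  | pair _ _ h₁ h₂ =>
    obtain ⟨g, hg⟩ := h₁
    obtain ⟨j, hj⟩ := h₂
    exact ⟨_, hg.pair hj⟩
  | comp _ _ h₁ h₂ =>
    obtain ⟨g, hg⟩ := h₁
    obtain ⟨j, hj⟩ := h₂
    exact ⟨_, hg.comp hj⟩
  | prec _ _ h₁ h₂ =>
    obtain ⟨g, hg⟩ := h₁
    obtain ⟨j, hj⟩ := h₂
    exact ⟨_, hg.prec hj⟩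
  | rfind _ h₁ =>
    obtain ⟨g, hg⟩ := h₁
    exact ⟨_, hg.rfind⟩

open Nat.Partrec (Code)

/-- The set of all `u` such that the program `e` halts on `(σ, u)` for an initial segment `σ`
of `X`. -/
def enumSet (e : Code) (X : ℕ → Bool) : Set ℕ :=
  {u | ∃ k, (e.eval (Encodable.encode (initSeg X k, u))).Dom}

/-- Since `e` is an oracle-free program, only countably many cases remain. -/
theorem Enumerates.exists_code {X : ℕ → Bool} {H : Set ℕ} (h : Enumerates X H) :
    ∃ e : Code, H = enumSet e X := by
  obtain ⟨f, hf, rfl⟩ := h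
  obtain ⟨g, hg⟩ := hf.exists_approxAlong
  obtain ⟨e, he⟩ := Code.exists_code.1 hg.partrec
  refine ⟨e, Set.ext fun u => ?_⟩
  have key : ∀ k, (e.eval (Encodable.encode (initSeg X k, u))).Dom ↔ (g (initSeg X k) u).Dom := by
    intro k
    rw [he]
    simp only [Encodable.encodek, Part.coe_some, Part.bind_some]
    rfl
  have hf : u ∈ f.Dom ↔ ∃ k, (g (initSeg X k) u).Dom := by
    simp only [PFun.mem_dom, hg.mem_iff, Part.dom_iff_mem]
    exact exists_comm
  exact hf.trans (exists_congr fun k => (key k).symm)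

/-! ### The merging construction. -/

/-- `((s, c), T)` stands for: at stage `s` requirement `c` merges into the new component `s` every
component `r` with `T[r] ≠ 0`, with colours flipped if and only if `T[r] = 1`. -/
abbrev MergeAction := (ℕ × ℕ) × List ℕ

/-- `(n, c, P)`: a proof `n` that requirement `c` wants the pairs in `P` to be split. -/
abbrev SplitRequest := ℕ × ℕ × List (ℕ × ℕ)

/-- The effect of a merging action on the component and the colour of a vertex. -/
def mergeStep (p : ℕ × Bool) (a : MergeAction) : ℕ × Bool :=
  if a.2.getD p.1 0 = 0 then p else (a.1.1, p.2 ^^ decide (a.2.getD p.1 0 = 1))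

/-- Component and colour of the vertex `v` after the actions in `A`, the most recent one first. -/
def vertexInfo (A : List MergeAction) (v : ℕ) : ℕ × Bool :=
  A.foldr (fun a p => mergeStep p a) (v / 2, decide (v % 2 = 1))

/-- Requirement `d.2.1.2.1` may perform the action described by `d` at stage `s`. -/
def Acceptable (Q : SplitRequest → Prop) (s : ℕ) (A : List MergeAction)
    (d : ℕ × SplitRequest × List ℕ) : Prop :=
  -- Entries beyond the end of the list read as `0`, so the length bound protects component `s`
  -- itself and all later ones.
  Q d.2.1 ∧ (∀ a ∈ A, a.1.2 ≠ d.2.1.2.1) ∧ d.2.2.length ≤ s ∧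
    -- The priority restraint: a vertex `v` can be moved only by requirements below `v`.
    (∀ v < d.2.1.2.1 + 1, d.2.2.getD (vertexInfo A v).1 0 = 0) ∧
    ∀ p ∈ d.2.1.2.2,
      (mergeStep (vertexInfo A p.1) ((s, d.2.1.2.1), d.2.2)).1 = s ∧
      (mergeStep (vertexInfo A p.2) ((s, d.2.1.2.1), d.2.2)).1 = s ∧
      (mergeStep (vertexInfo A p.1) ((s, d.2.1.2.1), d.2.2)).2 ≠
        (mergeStep (vertexInfo A p.2) ((s, d.2.1.2.1), d.2.2)).2

open Classical in
/-- The actions performed up to stage `s` if `o` is proposed at stage `s`. -/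
noncomputable def tryAction (Q : SplitRequest → Prop) (q : ℕ × List MergeAction)
    (o : Option (ℕ × SplitRequest × List ℕ)) : List MergeAction :=
  o.elim q.2 fun d => if Acceptable Q q.1 q.2 d then ((q.1, d.2.1.2.1), d.2.2) :: q.2 else q.2

/-- The actions performed up to stage `s`, given the list `A` of those performed before. -/
noncomputable def stageStep (Q : SplitRequest → Prop) (s : ℕ) (A : List MergeAction) :
    List MergeAction :=
  tryAction Q (s, A) (Encodable.decode s)

/-- The actions performed before stage `s`. -/
noncomputable def actionsBefore (Q : SplitRequest → Prop) (s : ℕ) : List MergeAction :=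
  s.rec [] (stageStep Q)

/-- Component and colour of the vertex `v` at the start of stage `s`. -/
noncomputable def infoAt (Q : SplitRequest → Prop) (s v : ℕ) : ℕ × Bool :=
  vertexInfo (actionsBefore Q s) v

/-! ### The construction is primitive recursive. -/

section Primrec

open Primrec

theorem primrec_mergeStep : Primrec₂ mergeStep := by
  have hval : Primrec fun q : (ℕ × Bool) × MergeAction => q.2.2.getD q.1.1 0 :=
    (Primrec.list_getD 0).comp (snd.comp snd) (fst.comp fst)
  refine Primrec.ite (Primrec.eq.comp hval (const 0)) fst (Primrec.pair (fst.comp (fst.comp snd)) ?_)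
  exact (Primrec.dom_finite fun b : Bool × Bool => b.1 ^^ b.2).comp
    (Primrec.pair (snd.comp fst) (PrimrecPred.decide (Primrec.eq.comp hval (const 1))))

theorem primrec_vertexInfo : Primrec₂ vertexInfo := by
  refine Primrec.list_foldr (f := fun q : List MergeAction × ℕ => q.1)
    (g := fun q => (q.2 / 2, decide (q.2 % 2 = 1)))
    (h := fun _ r => mergeStep r.2 r.1) fst (Primrec.pair ?_ ?_) ?_
  · exact Primrec.nat_div.comp snd (const 2)
  · exact PrimrecPred.decide (Primrec.eq.comp (Primrec.nat_mod.comp snd (const 2)) (const 1))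
  · exact primrec_mergeStep.comp (snd.comp snd) (fst.comp snd)

variable {Q : SplitRequest → Prop}

theorem primrecPred_acceptable (hQ : PrimrecPred Q) :
    PrimrecPred fun q : (ℕ × List MergeAction) × (ℕ × SplitRequest × List ℕ) =>
      Acceptable Q q.1.1 q.1.2 q.2 := by
  let Ctx := (ℕ × List MergeAction) × (ℕ × SplitRequest × List ℕ)
  have hs : Primrec fun q : Ctx => q.1.1 := fst.comp fst
  have hA : Primrec fun q : Ctx => q.1.2 := snd.comp fst
  have hr : Primrec fun q : Ctx => q.2.2.1 := fst.comp (snd.comp snd)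
  have hc : Primrec fun q : Ctx => q.2.2.1.2.1 := fst.comp (snd.comp hr)
  have hP : Primrec fun q : Ctx => q.2.2.1.2.2 := snd.comp (snd.comp hr)
  have hT : Primrec fun q : Ctx => q.2.2.2 := snd.comp (snd.comp snd)
  refine (hQ.comp hr).and (PrimrecPred.and ?_ (PrimrecPred.and ?_ (PrimrecPred.and ?_ ?_)))
  · have : PrimrecRel fun (a : MergeAction) (q : Ctx) => a.1.2 ≠ q.2.2.1.2.1 :=
      (Primrec.eq.comp (snd.comp (fst.comp fst)) (hc.comp snd)).not
    exact this.forall_mem_list.comp hA Primrec.id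
  · exact Primrec.nat_le.comp (Primrec.list_length.comp hT) hs
  · have : PrimrecRel fun (v : ℕ) (q : Ctx) => q.2.2.2.getD (vertexInfo q.1.2 v).1 0 = 0 :=
      Primrec.eq.comp ((Primrec.list_getD 0).comp (hT.comp snd)
        (fst.comp (primrec_vertexInfo.comp (hA.comp snd) fst))) (const 0)
    refine (this.forall_mem_list.comp (Primrec.list_range.comp (Primrec.succ.comp hc))
      Primrec.id).of_eq fun q => ?_
    simp only [List.mem_range]
    rfl
  · have step : ∀ {f : (ℕ × ℕ) × Ctx → ℕ}, Primrec f → Primrec fun r =>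
        mergeStep (vertexInfo r.2.1.2 (f r)) ((r.2.1.1, r.2.2.2.1.2.1), r.2.2.2.2) := fun hf =>
      primrec_mergeStep.comp (primrec_vertexInfo.comp (hA.comp snd) hf)
        (Primrec.pair (Primrec.pair (hs.comp snd) (hc.comp snd)) (hT.comp snd))
    have : PrimrecRel fun (p : ℕ × ℕ) (q : Ctx) =>
        (mergeStep (vertexInfo q.1.2 p.1) ((q.1.1, q.2.2.1.2.1), q.2.2.2)).1 = q.1.1 ∧
        (mergeStep (vertexInfo q.1.2 p.2) ((q.1.1, q.2.2.1.2.1), q.2.2.2)).1 = q.1.1 ∧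
        (mergeStep (vertexInfo q.1.2 p.1) ((q.1.1, q.2.2.1.2.1), q.2.2.2)).2 ≠
          (mergeStep (vertexInfo q.1.2 p.2) ((q.1.1, q.2.2.1.2.1), q.2.2.2)).2 := by
      have h₁ := step (fst.comp fst)
      have h₂ := step (snd.comp fst)
      exact (Primrec.eq.comp (fst.comp h₁) (hs.comp snd)).and
        ((Primrec.eq.comp (fst.comp h₂) (hs.comp snd)).and
          (Primrec.eq.comp (snd.comp h₁) (snd.comp h₂)).not)
    exact this.forall_mem_list.comp hP Primrec.id

theorem primrec_tryAction (hQ : PrimrecPred Q) : Primrec₂ (tryAction Q) := by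
  classical
  let Ctx := (ℕ × List MergeAction) × (ℕ × SplitRequest × List ℕ)
  have hs : Primrec fun q : Ctx => q.1.1 := fst.comp fst
  have hA : Primrec fun q : Ctx => q.1.2 := snd.comp fst
  have hr : Primrec fun q : Ctx => q.2.2.1 := fst.comp (snd.comp snd)
  have hc : Primrec fun q : Ctx => q.2.2.1.2.1 := fst.comp (snd.comp hr)
  have hT : Primrec fun q : Ctx => q.2.2.2 := snd.comp (snd.comp snd)
  have hcons : Primrec fun q : Ctx => ((q.1.1, q.2.2.1.2.1), q.2.2.2) :: q.1.2 :=
    Primrec.list_cons.comp ((hs.pair hc).pair hT) hA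
  have hite : Primrec fun q : Ctx => if Acceptable Q q.1.1 q.1.2 q.2
      then ((q.1.1, q.2.2.1.2.1), q.2.2.2) :: q.1.2 else q.1.2 :=
    Primrec.ite (primrecPred_acceptable hQ) hcons hA
  have h : Primrec fun r : (ℕ × List MergeAction) × Option (ℕ × SplitRequest × List ℕ) =>
      tryAction Q r.1 r.2 := by
    refine Primrec.of_eq (Primrec.option_casesOn snd (snd.comp fst)
      (hite.comp ((fst.comp fst).pair snd)).to₂) ?_
    rintro ⟨q, _ | d⟩
    · rfl
    · simp only [tryAction, Option.elim]
  exact h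

theorem primrec_stageStep (hQ : PrimrecPred Q) : Primrec₂ (stageStep Q) :=
  (primrec_tryAction hQ).comp Primrec.id (Primrec.decode.comp fst)

theorem primrec_actionsBefore (hQ : PrimrecPred Q) : Primrec (actionsBefore Q) :=
  (Primrec.nat_rec₁ [] (primrec_stageStep hQ)).of_eq fun _ => rfl

theorem primrec_infoAt (hQ : PrimrecPred Q) : Primrec₂ (infoAt Q) :=
  primrec_vertexInfo.comp ((primrec_actionsBefore hQ).comp fst) snd

end Primrec

/-! ### Invariants of the construction and the resulting graph. -/

section Merging

variable {Q : SplitRequest → Prop}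

theorem mergeStep_of_eq_zero {p : ℕ × Bool} {a : MergeAction} (h : a.2.getD p.1 0 = 0) :
    mergeStep p a = p := if_pos h

theorem mergeStep_of_ne_zero {p : ℕ × Bool} {a : MergeAction} (h : a.2.getD p.1 0 ≠ 0) :
    mergeStep p a = (a.1.1, p.2 ^^ decide (a.2.getD p.1 0 = 1)) := if_neg h

/-- Both vertices read the same entry of the list, so both colours are reversed or neither is. -/
theorem mergeStep_congr {p q : ℕ × Bool} {a : MergeAction} (h : p.1 = q.1) :
    (mergeStep p a).1 = (mergeStep q a).1 ∧
      ((mergeStep p a).2 = (mergeStep q a).2 ↔ p.2 = q.2) := by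
  by_cases h0 : a.2.getD p.1 0 = 0
  · rw [mergeStep_of_eq_zero h0, mergeStep_of_eq_zero (h ▸ h0)]
    exact ⟨h, Iff.rfl⟩
  · rw [mergeStep_of_ne_zero h0, mergeStep_of_ne_zero (h ▸ h0), h]
    exact ⟨rfl, Bool.xor_left_inj⟩

/-- At stage `s` the action described by `d` is performed. -/
def ActsAt (Q : SplitRequest → Prop) (s : ℕ) (d : ℕ × SplitRequest × List ℕ) : Prop :=
  Encodable.decode s = some d ∧ Acceptable Q s (actionsBefore Q s) d

theorem actionsBefore_succ_of_actsAt {s : ℕ} {d : ℕ × SplitRequest × List ℕ} (h : ActsAt Q s d) :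
    actionsBefore Q (s + 1) = ((s, d.2.1.2.1), d.2.2) :: actionsBefore Q s := by
  change tryAction Q (s, actionsBefore Q s) (Encodable.decode s) = _
  rw [h.1]
  exact if_pos h.2

theorem actionsBefore_succ_of_not_actsAt {s : ℕ} (h : ¬ ∃ d, ActsAt Q s d) :
    actionsBefore Q (s + 1) = actionsBefore Q s := by
  change tryAction Q (s, actionsBefore Q s) (Encodable.decode s) = _
  rcases hd : (Encodable.decode s : Option (ℕ × SplitRequest × List ℕ)) with _ | d
  · rfl
  · exact if_neg fun hA => h ⟨d, hd, hA⟩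

theorem infoAt_succ_of_actsAt {s : ℕ} {d : ℕ × SplitRequest × List ℕ} (h : ActsAt Q s d) (v : ℕ) :
    infoAt Q (s + 1) v = mergeStep (infoAt Q s v) ((s, d.2.1.2.1), d.2.2) := by
  rw [infoAt, actionsBefore_succ_of_actsAt h]
  rfl

theorem infoAt_succ_of_not_actsAt {s : ℕ} (h : ¬ ∃ d, ActsAt Q s d) (v : ℕ) :
    infoAt Q (s + 1) v = infoAt Q s v := by
  rw [infoAt, actionsBefore_succ_of_not_actsAt h, infoAt]

/-- A stage either leaves a vertex alone or moves it from an older component to the component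
created at this stage. -/
theorem infoAt_succ_cases (Q : SplitRequest → Prop) (s v : ℕ) :
    infoAt Q (s + 1) v = infoAt Q s v ∨
      (infoAt Q (s + 1) v).1 = s ∧ (infoAt Q s v).1 < s ∧
        ∃ d, ActsAt Q s d ∧ d.2.1.2.1 < v := by
  by_cases h : ∃ d, ActsAt Q s d
  · obtain ⟨d, hd⟩ := h
    rw [infoAt_succ_of_actsAt hd]
    by_cases h0 : d.2.2.getD (infoAt Q s v).1 0 = 0
    · exact .inl (mergeStep_of_eq_zero h0)
    · refine .inr ⟨by rw [mergeStep_of_ne_zero h0], ?_, d, hd, ?_⟩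
      · refine lt_of_lt_of_le ?_ hd.2.2.2.1
        by_contra hlt
        exact h0 (List.getD_eq_default _ _ (not_lt.1 hlt))
      · by_contra hlt
        exact h0 (hd.2.2.2.2.1 v (by omega))
  · exact .inl (infoAt_succ_of_not_actsAt h v)

theorem infoAt_of_le {s v : ℕ} (h : s ≤ v / 2) : infoAt Q s v = (v / 2, decide (v % 2 = 1)) := by
  induction s with
  | zero => rfl
  | succ s ih =>
    have ih := ih (by omega)
    rcases infoAt_succ_cases Q s v with h' | h'
    · rw [h', ih]
    · rw [ih] at h'
      have := h'.2.1
      simp only at this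
      omega

theorem half_le_infoAt_fst (Q : SplitRequest → Prop) (s v : ℕ) : v / 2 ≤ (infoAt Q s v).1 := by
  induction s with
  | zero => exact le_rfl
  | succ s ih =>
    rcases infoAt_succ_cases Q s v with h | h
    · rwa [h]
    · omega

/-- Components are never separated and relative colours inside them are permanent; this keeps edges,
once drawn, compatible with all later colourings. -/
theorem infoAt_congr_of_le {s t v w : ℕ} (hst : s ≤ t)
    (h : (infoAt Q s v).1 = (infoAt Q s w).1) :
    (infoAt Q t v).1 = (infoAt Q t w).1 ∧
      ((infoAt Q t v).2 = (infoAt Q t w).2 ↔ (infoAt Q s v).2 = (infoAt Q s w).2) := by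
  induction t, hst using Nat.le_induction with
  | base => exact ⟨h, Iff.rfl⟩
  | succ t _ ih =>
    by_cases ha : ∃ d, ActsAt Q t d
    · obtain ⟨d, hd⟩ := ha
      simp only [infoAt_succ_of_actsAt hd]
      exact ⟨(mergeStep_congr ih.1).1, (mergeStep_congr ih.1).2.trans ih.2⟩
    · simpa only [infoAt_succ_of_not_actsAt ha] using ih

theorem mem_actionsBefore_of_actsAt {s t : ℕ} {d : ℕ × SplitRequest × List ℕ} (h : ActsAt Q s d)
    (hst : s < t) : ((s, d.2.1.2.1), d.2.2) ∈ actionsBefore Q t := by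
  induction t, hst using Nat.le_induction with
  | base => simp [actionsBefore_succ_of_actsAt h]
  | succ t _ ih =>
    by_cases ha : ∃ d, ActsAt Q t d
    · obtain ⟨d', hd⟩ := ha
      exact actionsBefore_succ_of_actsAt hd ▸ List.mem_cons_of_mem _ ih
    · exact actionsBefore_succ_of_not_actsAt ha ▸ ih

theorem exists_actsAt_of_mem_actionsBefore {t : ℕ} {a : MergeAction}
    (h : a ∈ actionsBefore Q t) : ∃ s d, ActsAt Q s d ∧ d.2.1.2.1 = a.1.2 := by
  induction t with
  | zero => simp [actionsBefore] at h
  | succ t ih =>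
    by_cases ha : ∃ d, ActsAt Q t d
    · obtain ⟨d, hd⟩ := ha
      rw [actionsBefore_succ_of_actsAt hd, List.mem_cons] at h
      rcases h with rfl | h
      · exact ⟨t, d, hd, rfl⟩
      · exact ih h
    · exact ih (actionsBefore_succ_of_not_actsAt ha ▸ h)

/-- Every requirement acts at most once. -/
theorem exists_forall_not_actsAt (Q : SplitRequest → Prop) (c : ℕ) :
    ∃ s₀, ∀ s ≥ s₀, ∀ d, ActsAt Q s d → d.2.1.2.1 ≠ c := by
  by_cases h : ∃ s d, ActsAt Q s d ∧ d.2.1.2.1 = c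
  · obtain ⟨s, d, hd, rfl⟩ := h
    refine ⟨s + 1, fun t ht d' hd' heq => ?_⟩
    exact hd'.2.2.1 _ (mem_actionsBefore_of_actsAt hd ht) heq.symm
  · push Not at h
    exact ⟨0, fun s _ d hd => h s d hd⟩

/-- Only the finitely many requirements below `v` may move `v`, and each acts at most once. -/
theorem exists_infoAt_eventually_const (Q : SplitRequest → Prop) (v : ℕ) :
    ∃ s₀, ∀ s ≥ s₀, infoAt Q s v = infoAt Q s₀ v := by
  choose b hb using exists_forall_not_actsAt Q
  refine ⟨(Finset.range v).sup b, fun s hs => ?_⟩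
  induction s, hs using Nat.le_induction with
  | base => rfl
  | succ s hs ih =>
    rcases infoAt_succ_cases Q s v with h | ⟨-, -, d, hd, hlt⟩
    · rw [h, ih]
    · exact absurd rfl (hb d.2.1.2.1 s ((Finset.le_sup (Finset.mem_range.2 hlt)).trans hs) d hd)

/-- A stage from which on component and colour of `v` do not change. -/
noncomputable def settlingStage (Q : SplitRequest → Prop) (v : ℕ) : ℕ :=
  (exists_infoAt_eventually_const Q v).choose

/-- The final component and colour of `v`. -/
noncomputable def finalInfo (Q : SplitRequest → Prop) (v : ℕ) : ℕ × Bool :=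
  infoAt Q (settlingStage Q v) v

theorem infoAt_eq_finalInfo {s v : ℕ} (h : settlingStage Q v ≤ s) :
    infoAt Q s v = finalInfo Q v :=
  (exists_infoAt_eventually_const Q v).choose_spec s h

theorem half_le_finalInfo_fst (Q : SplitRequest → Prop) (v : ℕ) : v / 2 ≤ (finalInfo Q v).1 :=
  half_le_infoAt_fst _ _ _

theorem finalInfo_congr {s v w : ℕ} (h : (infoAt Q s v).1 = (infoAt Q s w).1) :
    (finalInfo Q v).2 = (finalInfo Q w).2 ↔ (infoAt Q s v).2 = (infoAt Q s w).2 := by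
  let t := max s (max (settlingStage Q v) (settlingStage Q w))
  rw [← infoAt_eq_finalInfo (s := t) (v := v) (by omega),
    ← infoAt_eq_finalInfo (s := t) (v := w) (by omega)]
  exact (infoAt_congr_of_le (le_max_left _ _) h).2

/-- The vertices `2 * s` and `2 * s + 1` appear at the end of stage `s` and are joined to the
vertices of the other colour in their component. -/
noncomputable def mergeGraph (Q : SplitRequest → Prop) : SimpleGraph ℕ where
  Adj v w := (infoAt Q (max v w / 2 + 1) v).1 = (infoAt Q (max v w / 2 + 1) w).1 ∧
    (infoAt Q (max v w / 2 + 1) v).2 ≠ (infoAt Q (max v w / 2 + 1) w).2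
  symm := ⟨fun v w h => by rw [max_comm w v]; exact ⟨h.1.symm, h.2.symm⟩⟩
  loopless := ⟨fun v h => h.2 rfl⟩

/-- Whether `v` and `w` are adjacent is fixed when the larger of them appears, so finitely many
stages decide it. -/
theorem recursiveGraph_mergeGraph (hQ : PrimrecPred Q) : RecursiveGraph (mergeGraph Q) := by
  have hm : Primrec fun p : ℕ × ℕ => max p.1 p.2 / 2 + 1 :=
    Primrec.succ.comp (Primrec.nat_div.comp (Primrec.nat_max.comp Primrec.fst Primrec.snd)
      (Primrec.const 2))
  have h₁ := (primrec_infoAt hQ).comp hm Primrec.fst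
  have h₂ := (primrec_infoAt hQ).comp hm Primrec.snd
  have : PrimrecPred fun p : ℕ × ℕ => (mergeGraph Q).Adj p.1 p.2 :=
    (Primrec.eq.comp (Primrec.fst.comp h₁) (Primrec.fst.comp h₂)).and
      (Primrec.eq.comp (Primrec.snd.comp h₁) (Primrec.snd.comp h₂)).not
  obtain ⟨i, hi⟩ := this
  exact ⟨i, hi.to_comp⟩

/-- The final colours colour the graph. -/
noncomputable def mergeColoring (Q : SplitRequest → Prop) : (mergeGraph Q).Coloring Bool :=
  SimpleGraph.Coloring.mk (fun v => (finalInfo Q v).2) fun h he =>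
    h.2 ((finalInfo_congr h.1).1 he)

theorem isBipartite_mergeGraph (Q : SplitRequest → Prop) : (mergeGraph Q).IsBipartite := by
  have := (mergeColoring Q).colorable
  rwa [Fintype.card_bool] at this

theorem mergeGraph_adj_new (Q : SplitRequest → Prop) (s : ℕ) :
    (infoAt Q (s + 1) (2 * s)).1 = s ∧ (infoAt Q (s + 1) (2 * s + 1)).1 = s ∧
      (mergeGraph Q).Adj (2 * s) (2 * s + 1) := by
  have h₀ : infoAt Q s (2 * s) = (s, false) := by
    rw [infoAt_of_le (by omega)]
    ext <;> simp
  have h₁ : infoAt Q s (2 * s + 1) = (s, true) := by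
    rw [infoAt_of_le (by omega)]
    ext
    · simp only; omega
    · simp [Nat.add_mod]
  have hm : max (2 * s) (2 * s + 1) / 2 + 1 = s + 1 := by omega
  have h := infoAt_congr_of_le (Q := Q) (Nat.le_succ s)
    (show (infoAt Q s (2 * s)).1 = (infoAt Q s (2 * s + 1)).1 by rw [h₀, h₁])
  have h0 : (infoAt Q (s + 1) (2 * s)).1 = s := by
    rcases infoAt_succ_cases Q s (2 * s) with h | h
    · rw [h, h₀]
    · exact h.1
  refine ⟨h0, h.1.symm.trans h0, ?_⟩
  change (infoAt Q _ _).1 = (infoAt Q _ _).1 ∧ (infoAt Q _ _).2 ≠ (infoAt Q _ _).2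
  rw [hm]
  refine ⟨h.1, fun he => ?_⟩
  have := h.2.1 he
  rw [h₀, h₁] at this
  exact Bool.noConfusion this

/-- The two new vertices have opposite colours and are adjacent; an older vertex of component `s` is
adjacent to whichever differs from it in colour. -/
theorem reachable_new_of_infoAt_succ {s v : ℕ} (h : (infoAt Q (s + 1) v).1 = s) :
    (mergeGraph Q).Reachable v (2 * s) := by
  obtain ⟨h₀, h₁, hadj⟩ := mergeGraph_adj_new Q s
  have hle := half_le_infoAt_fst Q (s + 1) v
  rw [h] at hle
  rcases hle.lt_or_eq with hlt | heq
  · have hm₀ : max v (2 * s) / 2 + 1 = s + 1 := by omega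
    have hm₁ : max v (2 * s + 1) / 2 + 1 = s + 1 := by omega
    by_cases hc : (infoAt Q (s + 1) v).2 = (infoAt Q (s + 1) (2 * s)).2
    · have : (mergeGraph Q).Adj v (2 * s + 1) := by
        change (infoAt Q _ _).1 = (infoAt Q _ _).1 ∧ (infoAt Q _ _).2 ≠ (infoAt Q _ _).2
        rw [hm₁]
        refine ⟨h.trans h₁.symm, ?_⟩
        have h2 := hadj.2
        rw [show max (2 * s) (2 * s + 1) / 2 + 1 = s + 1 by omega] at h2
        rwa [hc]
      exact this.reachable.trans hadj.reachable.symm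
    · have : (mergeGraph Q).Adj v (2 * s) := by
        change (infoAt Q _ _).1 = (infoAt Q _ _).1 ∧ (infoAt Q _ _).2 ≠ (infoAt Q _ _).2
        rw [hm₀]
        exact ⟨h.trans h₀.symm, hc⟩
      exact this.reachable
  · have : v = 2 * s ∨ v = 2 * s + 1 := by omega
    rcases this with rfl | rfl
    · exact SimpleGraph.Reachable.refl _
    · exact hadj.reachable.symm

theorem reachable_of_infoAt_fst_eq {s v w : ℕ} (h : (infoAt Q s v).1 = (infoAt Q s w).1) :
    (mergeGraph Q).Reachable v w := by
  induction s with
  | zero =>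
    have h : v / 2 = w / 2 := h
    have key : ∀ u, (mergeGraph Q).Reachable u (2 * (u / 2)) := by
      intro u
      have : u = 2 * (u / 2) ∨ u = 2 * (u / 2) + 1 := by omega
      rcases this with h' | h'
      · rw [← h']
      · conv_lhs => rw [h']
        exact (mergeGraph_adj_new Q (u / 2)).2.2.reachable.symm
    exact (h ▸ key v).trans (key w).symm
  | succ s ih =>
    by_cases hs : (infoAt Q (s + 1) v).1 = s
    · exact (reachable_new_of_infoAt_succ hs).trans
        (reachable_new_of_infoAt_succ (h ▸ hs)).symm
    · have aux : ∀ {u}, (infoAt Q (s + 1) u).1 ≠ s → infoAt Q (s + 1) u = infoAt Q s u :=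
        fun {u} hu => (infoAt_succ_cases Q s u).resolve_right fun h => hu h.1
      exact ih (by rw [← aux hs, h, aux (h ▸ hs)])

/-- Any path between vertices of different colours is odd, and the colour difference at stage `s`
persists in the final colouring. -/
theorem exists_odd_path_of_infoAt {s v w : ℕ} (h : (infoAt Q s v).1 = (infoAt Q s w).1)
    (hne : (infoAt Q s v).2 ≠ (infoAt Q s w).2) :
    ∃ p : (mergeGraph Q).Walk v w, p.IsPath ∧ Odd p.length := by
  obtain ⟨p, hp⟩ := (reachable_of_infoAt_fst_eq h).exists_isPath
  refine ⟨p, hp, ((mergeColoring Q).odd_length_iff_not_congr p).2 ?_⟩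
  have : (finalInfo Q v).2 ≠ (finalInfo Q w).2 := fun he => hne ((finalInfo_congr h).1 he)
  change ¬ (finalInfo Q v).2 = true ↔ (finalInfo Q w).2 = true
  rwa [← not_iff, ← Bool.eq_iff_iff]

theorem exists_split_of_actsAt {s : ℕ} {d : ℕ × SplitRequest × List ℕ} (h : ActsAt Q s d) :
    Q d.2.1 ∧ ∀ p ∈ d.2.1.2.2,
      ∃ q : (mergeGraph Q).Walk p.1 p.2, q.IsPath ∧ Odd q.length := by
  refine ⟨h.2.1, fun p hp => ?_⟩
  have := h.2.2.2.2.2 p hp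
  have e : ∀ v, mergeStep (vertexInfo (actionsBefore Q s) v) ((s, d.2.1.2.1), d.2.2) =
      infoAt Q (s + 1) v := fun v => (infoAt_succ_of_actsAt h v).symm
  simp only [e] at this
  exact exists_odd_path_of_infoAt (s := s + 1) (this.1.trans this.2.1.symm) this.2.2

/-- A requirement that wants to split pairs of vertices in components it may touch, and that can do
so by flipping components, does eventually split a set of pairs. -/
theorem exists_split_of_request {n c : ℕ} {P : List (ℕ × ℕ)} (hQ : Q (n, c, P)) (flip : ℕ → Bool)
    (hP : ∀ p ∈ P,
      (∀ v ≤ c, (finalInfo Q v).1 ≠ (finalInfo Q p.1).1) ∧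
      (∀ v ≤ c, (finalInfo Q v).1 ≠ (finalInfo Q p.2).1) ∧
      ((finalInfo Q p.1).2 ^^ flip (finalInfo Q p.1).1) ≠
        ((finalInfo Q p.2).2 ^^ flip (finalInfo Q p.2).1)) :
    ∃ n P, Q (n, c, P) ∧
      ∀ p ∈ P, ∃ q : (mergeGraph Q).Walk p.1 p.2, q.IsPath ∧ Odd q.length := by
  classical
  -- Any action of `c` will do, even one on a different list of pairs; if `c` never acts, the
  -- proposal built below is accepted.
  suffices h : ∃ s d, ActsAt Q s d ∧ d.2.1.2.1 = c by
    obtain ⟨s, ⟨e, ⟨n, c, P⟩, T⟩, hd, rfl⟩ := h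
    exact ⟨n, P, exists_split_of_actsAt hd⟩
  obtain ⟨V, hV⟩ : ∃ V : Finset ℕ, (∀ v ≤ c, v ∈ V) ∧ ∀ p ∈ P, p.1 ∈ V ∧ p.2 ∈ V := by
    refine ⟨Finset.range (c + 1) ∪ (P.map Prod.fst).toFinset ∪ (P.map Prod.snd).toFinset,
      fun v hv => ?_, fun p hp => ?_⟩
    · simp [Nat.lt_succ_of_le hv]
    · constructor
      · have : p.1 ∈ (P.map Prod.fst).toFinset := by simpa using ⟨p.2, hp⟩
        simp only [Finset.mem_union, this, or_true, true_or]
      · have : p.2 ∈ (P.map Prod.snd).toFinset := by simpa using ⟨p.1, hp⟩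
        simp only [Finset.mem_union, this, or_true]
  let K := V.sup (fun v => (finalInfo Q v).1) + 1
  let T := (List.range K).map fun r =>
    if ∃ v ≤ c, (finalInfo Q v).1 = r then 0 else if flip r then 1 else 2
  -- The first entry is padding: it pushes the code, and hence the stage, past the settling stages
  -- of all vertices in `V` and past the length of `T`.
  let s := Encodable.encode (max K (V.sup (settlingStage Q)), ((n, c, P) : SplitRequest), T)
  have hs : max K (V.sup (settlingStage Q)) ≤ s := Nat.left_le_pair _ _
  have hinfo : ∀ v ∈ V, infoAt Q s v = finalInfo Q v := fun v hv =>
    infoAt_eq_finalInfo ((Finset.le_sup hv).trans ((le_max_right _ _).trans hs))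
  have hT : ∀ v ∈ V, T.getD (finalInfo Q v).1 0 =
      if ∃ u ≤ c, (finalInfo Q u).1 = (finalInfo Q v).1 then 0
      else if flip (finalInfo Q v).1 then 1 else 2 := by
    intro v hv
    have hlt : (finalInfo Q v).1 < K :=
      Nat.lt_succ_of_le (Finset.le_sup (f := fun v => (finalInfo Q v).1) hv)
    rw [List.getD_eq_getElem _ _ (by simpa [T] using hlt)]
    simp [T]
  have hstep : ∀ v ∈ V, (∀ u ≤ c, (finalInfo Q u).1 ≠ (finalInfo Q v).1) →
      mergeStep (infoAt Q s v) ((s, c), T) =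
        (s, (finalInfo Q v).2 ^^ flip (finalInfo Q v).1) := by
    intro v hv hne
    have h1 : T.getD (finalInfo Q v).1 0 = if flip (finalInfo Q v).1 then 1 else 2 := by
      rw [hT v hv, if_neg]
      push Not
      exact hne
    rw [hinfo v hv, mergeStep_of_ne_zero]
    · simp only [h1]
      cases flip (finalInfo Q v).1 <;> simp
    · simp only [h1]
      split_ifs <;> simp
  by_contra hno
  refine hno ⟨s, (max K (V.sup (settlingStage Q)), (n, c, P), T), ⟨Encodable.encodek _, hQ, ?_, ?_,
    ?_, ?_⟩, rfl⟩
  · intro a ha hc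
    obtain ⟨t, d, hd, he⟩ := exists_actsAt_of_mem_actionsBefore ha
    exact hno ⟨t, d, hd, he.trans hc⟩
  · simpa [T] using (le_max_left _ _).trans hs
  · intro v hv
    have hv : v ≤ c := Nat.le_of_lt_succ hv
    change T.getD (infoAt Q s v).1 0 = 0
    rw [hinfo v (hV.1 v hv), hT v (hV.1 v hv), if_pos ⟨v, hv, rfl⟩]
  · intro p hp
    obtain ⟨h₁, h₂, h₃⟩ := hP p hp
    have e₁ := hstep p.1 (hV.2 p hp).1 h₁
    have e₂ := hstep p.2 (hV.2 p hp).2 h₂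
    rw [infoAt] at e₁ e₂
    simp only [e₁, e₂]
    exact ⟨trivial, trivial, h₃⟩

end Merging

/-! ### Decidable split requests. -/

/-- The program `e` halts within `t` steps on `(ρ, u)` for an initial segment `ρ` of `τ` of length
at most `t`. -/
def HaltsWithin (e : Code) (t : ℕ) (τ : List Bool) (u : ℕ) : Prop :=
  ∃ k < t + 1, (e.evaln t (Encodable.encode (τ.take k, u))).isSome = true

theorem HaltsWithin.mono {e : Code} {X : ℕ → Bool} {s t u : ℕ} (hst : s ≤ t)
    (h : HaltsWithin e s (initSeg X s) u) : HaltsWithin e t (initSeg X t) u := by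
  obtain ⟨k, hk, h⟩ := h
  refine ⟨k, by omega, ?_⟩
  rw [take_initSeg X (by omega)] at h ⊢
  obtain ⟨x, hx⟩ := Option.isSome_iff_exists.1 h
  exact Option.isSome_iff_exists.2 ⟨x, Code.evaln_mono hst hx⟩

theorem HaltsWithin.mem_enumSet {e : Code} {X : ℕ → Bool} {t u : ℕ}
    (h : HaltsWithin e t (initSeg X t) u) : u ∈ enumSet e X := by
  obtain ⟨k, hk, h⟩ := h
  rw [take_initSeg X (by omega)] at h
  obtain ⟨x, hx⟩ := Option.isSome_iff_exists.1 h
  exact ⟨k, Part.dom_iff_mem.2 ⟨x, Code.evaln_sound hx⟩⟩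

theorem exists_haltsWithin_of_mem_enumSet {e : Code} {X : ℕ → Bool} {u : ℕ}
    (h : u ∈ enumSet e X) : ∃ t, HaltsWithin e t (initSeg X t) u := by
  obtain ⟨k, h⟩ := h
  obtain ⟨x, hx⟩ := Part.dom_iff_mem.1 h
  obtain ⟨m, hm⟩ := Code.evaln_complete.1 hx
  refine ⟨max k m, k, by omega, ?_⟩
  rw [take_initSeg X (le_max_left _ _)]
  exact Option.isSome_iff_exists.2 ⟨x, Code.evaln_mono (le_max_right _ _) hm⟩

/-- The list `w.2` of strings of length `w.1` witnesses that at least a third of the extensions of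
`a.1` enumerate, by the program `a.2`, both members of a pair in `P`. -/
def IsSplitWitness (a : List Bool × Code) (w : ℕ × List (List Bool)) (P : List (ℕ × ℕ)) : Prop :=
  (∀ i ∈ List.range w.2.length, ∀ j ∈ List.range w.2.length,
    w.2.getD i [] ≠ w.2.getD j [] ∨ i = j) ∧
  2 ^ w.1 ≤ 3 * w.2.length * 2 ^ a.1.length ∧
  ∀ τ ∈ w.2, τ.length = w.1 ∧ τ.take a.1.length = a.1 ∧
    ∃ p ∈ P, HaltsWithin a.2 w.1 τ p.1 ∧ HaltsWithin a.2 w.1 τ p.2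

/-- Bounded quantifiers over indices put distinctness in a form whose primitive recursiveness is
immediate. -/
theorem List.nodup_iff_getD {α : Type*} {d : α} {l : List α} :
    l.Nodup ↔ ∀ i ∈ List.range l.length, ∀ j ∈ List.range l.length,
      l.getD i d ≠ l.getD j d ∨ i = j := by
  simp only [List.mem_range, ← imp_iff_not_or, List.nodup_iff_injective_getElem,
    Function.Injective, Fin.ext_iff]
  constructor
  · intro h i hi j hj hij
    rw [List.getD_eq_getElem _ _ hi, List.getD_eq_getElem _ _ hj] at hij
    exact h (a₁ := ⟨i, hi⟩) (a₂ := ⟨j, hj⟩) hij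
  · intro h i j hij
    refine h i i.2 j j.2 ?_
    rwa [List.getD_eq_getElem _ _ i.2, List.getD_eq_getElem _ _ j.2]

/-- The requests of all requirements, where the requirement `c` codes a string and a program. -/
def IsSplitRequest (r : SplitRequest) : Prop :=
  -- The defaults are immaterial: only requirements of the form `encode (σ, e)` are ever needed.
  IsSplitWitness ((Encodable.decode r.2.1).getD ([], Code.zero)) ((Encodable.decode r.1).getD (0, []))
    r.2.2

theorem isSplitRequest_encode {a : List Bool × Code} {w : ℕ × List (List Bool)}
    {P : List (ℕ × ℕ)} :
    IsSplitRequest (Encodable.encode w, Encodable.encode a, P) ↔ IsSplitWitness a w P := by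
  simp only [IsSplitRequest, Encodable.encodek, Option.getD_some]

section Primrec

open Primrec

theorem primrecRel_haltsWithin :
    PrimrecRel fun (q : Code × ℕ × List Bool) (u : ℕ) => HaltsWithin q.1 q.2.1 q.2.2 u := by
  have h : PrimrecRel fun (k : ℕ) (r : (Code × ℕ × List Bool) × ℕ) =>
      (r.1.1.evaln r.1.2.1 (Encodable.encode (r.1.2.2.take k, r.2))).isSome = true := by
    have hr : Primrec fun q : ℕ × (Code × ℕ × List Bool) × ℕ => q.2.1 := fst.comp snd
    have ht : Primrec fun q : ℕ × (Code × ℕ × List Bool) × ℕ => q.2.1.2.1 :=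
      fst.comp (snd.comp hr)
    have hτ : Primrec fun q : ℕ × (Code × ℕ × List Bool) × ℕ => q.2.1.2.2.take q.1 :=
      Primrec.list_take.comp fst (snd.comp (snd.comp hr))
    exact Primrec.eq.comp (Primrec.option_isSome.comp (Code.primrec_evaln.comp
      ((ht.pair (fst.comp hr)).pair (Primrec.encode.comp (hτ.pair (snd.comp snd)))))) (const true)
  have hl : Primrec fun r : (Code × ℕ × List Bool) × ℕ => List.range (r.1.2.1 + 1) :=
    Primrec.list_range.comp (Primrec.succ.comp (fst.comp (snd.comp fst)))
  refine (h.exists_mem_list.comp hl Primrec.id).of_eq fun r => ?_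
  simp only [List.mem_range]
  rfl

theorem primrecPred_isSplitWitness :
    PrimrecPred fun q : ((List Bool × Code) × ℕ × List (List Bool)) × List (ℕ × ℕ) =>
      IsSplitWitness q.1.1 q.1.2 q.2 := by
  let Ctx := ((List Bool × Code) × ℕ × List (List Bool)) × List (ℕ × ℕ)
  have hσ : Primrec fun q : Ctx => q.1.1.1 := fst.comp (fst.comp fst)
  have he : Primrec fun q : Ctx => q.1.1.2 := snd.comp (fst.comp fst)
  have ht : Primrec fun q : Ctx => q.1.2.1 := fst.comp (snd.comp fst)
  have hL : Primrec fun q : Ctx => q.1.2.2 := snd.comp (snd.comp fst)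
  have hP : Primrec fun q : Ctx => q.2 := snd
  have hpow : Primrec fun n : ℕ => 2 ^ n := by
    refine (Primrec.nat_rec₁ 1 (f := fun _ m => 2 * m)
      (Primrec.nat_mul.comp (const 2) snd)).of_eq fun n => ?_
    induction n with
    | zero => rfl
    | succ n ih => rw [pow_succ', ← ih]
  refine PrimrecPred.and ?_ (PrimrecPred.and ?_ ?_)
  · have hrange : Primrec fun q : Ctx => List.range q.1.2.2.length :=
      Primrec.list_range.comp (Primrec.list_length.comp hL)
    have h₁ : PrimrecRel fun (j : ℕ) (r : ℕ × Ctx) =>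
        r.2.1.2.2.getD r.1 [] ≠ r.2.1.2.2.getD j [] ∨ r.1 = j := by
      have hL' : Primrec fun x : ℕ × ℕ × Ctx => x.2.2.1.2.2 := hL.comp (snd.comp snd)
      exact (Primrec.eq.comp ((Primrec.list_getD []).comp hL' (fst.comp snd))
        ((Primrec.list_getD []).comp hL' fst)).not.or (Primrec.eq.comp (fst.comp snd) fst)
    have h₂ : PrimrecRel fun (i : ℕ) (q : Ctx) => ∀ j ∈ List.range q.1.2.2.length,
        q.1.2.2.getD i [] ≠ q.1.2.2.getD j [] ∨ i = j :=
      h₁.forall_mem_list.comp (hrange.comp snd) Primrec.id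
    exact h₂.forall_mem_list.comp hrange Primrec.id
  · exact Primrec.nat_le.comp (hpow.comp ht) (Primrec.nat_mul.comp
      (Primrec.nat_mul.comp (const 3) (Primrec.list_length.comp hL))
      (hpow.comp (Primrec.list_length.comp hσ)))
  · have hp : PrimrecRel fun (p : ℕ × ℕ) (r : List Bool × Ctx) =>
        HaltsWithin r.2.1.1.2 r.2.1.2.1 r.1 p.1 ∧ HaltsWithin r.2.1.1.2 r.2.1.2.1 r.1 p.2 := by
      have hr : Primrec fun r : (ℕ × ℕ) × List Bool × Ctx =>
          (r.2.2.1.1.2, r.2.2.1.2.1, r.2.1) :=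
        (he.comp (snd.comp snd)).pair ((ht.comp (snd.comp snd)).pair (fst.comp snd))
      exact (primrecRel_haltsWithin.comp hr (fst.comp fst)).and
        (primrecRel_haltsWithin.comp hr (snd.comp fst))
    have : PrimrecRel fun (τ : List Bool) (q : Ctx) =>
        τ.length = q.1.2.1 ∧ τ.take q.1.1.1.length = q.1.1.1 ∧
          ∃ p ∈ q.2, HaltsWithin q.1.1.2 q.1.2.1 τ p.1 ∧ HaltsWithin q.1.1.2 q.1.2.1 τ p.2 :=
      (Primrec.eq.comp (Primrec.list_length.comp fst) (ht.comp snd)).and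
        ((Primrec.eq.comp (Primrec.list_take.comp (Primrec.list_length.comp (hσ.comp snd)) fst)
          (hσ.comp snd)).and (hp.exists_mem_list.comp (hP.comp snd) Primrec.id))
    exact this.forall_mem_list.comp hL Primrec.id

theorem primrecPred_isSplitRequest : PrimrecPred IsSplitRequest := by
  refine primrecPred_isSplitWitness.comp (Primrec.pair (Primrec.pair ?_ ?_) (snd.comp snd))
  · exact Primrec.option_getD.comp (Primrec.decode.comp (fst.comp snd)) (const _)
  · exact Primrec.option_getD.comp (Primrec.decode.comp fst) (const _)

end Primrec

/-! ### Measure of cylinders, density, and random flips. -/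

section Measure

open MeasureTheory
open scoped ENNReal

instance : IsProbabilityMeasure cantorMeasure := by
  unfold cantorMeasure
  infer_instance

theorem initSeg_eq_iff {X : ℕ → Bool} {τ : List Bool} :
    initSeg X τ.length = τ ↔ ∀ i ∈ Finset.range τ.length, X i = τ.getD i false := by
  constructor
  · intro h i hi
    have hi := Finset.mem_range.1 hi
    rw [List.getD_eq_getElem?_getD, ← h, getElem?_initSeg, if_pos (by simpa using hi)]
    rfl
  · intro h
    refine List.ext_getElem (length_initSeg _ _) fun i h₁ h₂ => ?_
    have := h i (Finset.mem_range.2 h₂)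
    rw [List.getD_eq_getElem _ _ h₂] at this
    simpa [initSeg] using this

theorem setOf_initSeg_eq (τ : List Bool) : {X : ℕ → Bool | initSeg X τ.length = τ} =
    Set.pi (Finset.range τ.length) fun i => {τ.getD i false} := by
  ext X
  exact initSeg_eq_iff

theorem measurableSet_initSeg_eq (t : ℕ) (τ : List Bool) :
    MeasurableSet {X : ℕ → Bool | initSeg X t = τ} := by
  by_cases h : τ.length = t
  · subst h
    rw [setOf_initSeg_eq]
    exact MeasurableSet.pi (Finset.countable_toSet _) fun _ _ => MeasurableSet.of_discrete
  · convert MeasurableSet.empty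
    refine Set.eq_empty_of_forall_notMem fun X hX => h ?_
    have hX : initSeg X t = τ := hX
    rw [← hX, length_initSeg]

theorem cantorMeasure_initSeg_eq (τ : List Bool) :
    cantorMeasure {X : ℕ → Bool | initSeg X τ.length = τ} = (2⁻¹ : ℝ≥0∞) ^ τ.length := by
  rw [setOf_initSeg_eq, cantorMeasure,
    Measure.infinitePi_pi _ fun _ _ => MeasurableSet.of_discrete]
  simp

theorem cantorMeasure_initSeg_mem {t : ℕ} {S : Finset (List Bool)} (hS : ∀ τ ∈ S, τ.length = t) :
    cantorMeasure {X : ℕ → Bool | initSeg X t ∈ S} = S.card * (2⁻¹ : ℝ≥0∞) ^ t := by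
  have : {X : ℕ → Bool | initSeg X t ∈ S} = ⋃ τ ∈ S, {X | initSeg X t = τ} := by
    ext X
    simp
  have hdisj : Set.PairwiseDisjoint (S : Set (List Bool))
      fun τ => {X : ℕ → Bool | initSeg X t = τ} := fun τ _ ρ _ hne =>
    Set.disjoint_left.2 fun X h₁ h₂ => hne (Eq.trans (Eq.symm h₁) h₂)
  rw [this, measure_biUnion_finset hdisj fun τ _ => measurableSet_initSeg_eq t τ,
    Finset.sum_congr rfl fun τ hτ => (hS τ hτ ▸ cantorMeasure_initSeg_eq τ :
      cantorMeasure {X | initSeg X t = τ} = (2⁻¹ : ℝ≥0∞) ^ t)]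
  simp

theorem measurableSet_initSeg_mem (t : ℕ) (S : Finset (List Bool)) :
    MeasurableSet {X : ℕ → Bool | initSeg X t ∈ S} := by
  have : {X : ℕ → Bool | initSeg X t ∈ S} = ⋃ τ ∈ S, {X | initSeg X t = τ} := by
    ext X
    simp
  rw [this]
  exact S.measurableSet_biUnion fun τ _ => measurableSet_initSeg_eq t τ

theorem initSeg_eq_of_le {X Y : ℕ → Bool} {k l : ℕ} (hkl : k ≤ l) (h : initSeg X l = initSeg Y l) :
    initSeg X k = initSeg Y k := by
  rw [← take_initSeg X hkl, h, take_initSeg Y hkl]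

theorem exists_initSeg_subset_of_isOpen {U : Set (ℕ → Bool)} (hU : IsOpen U) {X : ℕ → Bool}
    (hX : X ∈ U) : ∃ n, ∀ Y, initSeg Y n = initSeg X n → Y ∈ U := by
  obtain ⟨I, u, hu, hsub⟩ := isOpen_pi_iff.1 hU X hX
  refine ⟨I.sup id + 1, fun Y hY => hsub fun i hi => ?_⟩
  have hlt : i < I.sup id + 1 := Nat.lt_succ_of_le (Finset.le_sup (f := id) hi)
  have : (initSeg Y (I.sup id + 1))[i]? = (initSeg X (I.sup id + 1))[i]? := by rw [hY]
  rw [getElem?_initSeg, getElem?_initSeg, if_pos hlt, if_pos hlt, Option.some_inj] at this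
  rw [this]
  exact (hu i hi).2

/-- A weak form of the Lebesgue density theorem for Cantor space. -/
theorem cantorMeasure_eq_zero_of_forall_le {B : Set (ℕ → Bool)} {r : ℝ≥0∞} (hr : r < 1)
    (hB : ∀ σ : List Bool, cantorMeasure (B ∩ {X | initSeg X σ.length = σ}) ≤
      r * cantorMeasure {X | initSeg X σ.length = σ}) : cantorMeasure B = 0 := by
  -- `U` is the increasing union of its parts `V n` made of cylinders of length `n`; on each of
  -- these the hypothesis is summed. `B` need not be measurable.
  have key : ∀ U, IsOpen U → B ⊆ U → cantorMeasure B ≤ r * cantorMeasure U := by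
    intro U hU hBU
    let V : ℕ → Set (ℕ → Bool) := fun n => {X | ∀ Y, initSeg Y n = initSeg X n → Y ∈ U}
    have hVmono : Monotone V := fun m n hmn X hX Y hY => hX Y (initSeg_eq_of_le hmn hY)
    have hBV : B = ⋃ n, B ∩ V n := by
      rw [← Set.inter_iUnion, eq_comm, Set.inter_eq_left]
      intro X hX
      exact Set.mem_iUnion.2 (exists_initSeg_subset_of_isOpen hU (hBU hX))
    have hmono : Monotone fun n => B ∩ V n := fun m n hmn =>
      Set.inter_subset_inter_right _ (hVmono hmn)
    rw [hBV, hmono.measure_iUnion]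
    refine iSup_le fun n => ?_
    classical
    let S : Finset (List Bool) := (List.finite_length_eq Bool n).toFinset.filter
      fun τ => ∀ Y, initSeg Y n = τ → Y ∈ U
    have hS : ∀ τ ∈ S, τ.length = n := fun τ hτ => by
      simpa using (Finset.mem_filter.1 hτ).1
    have hVS : V n = {X | initSeg X n ∈ S} := by
      ext X
      simp [V, S, length_initSeg]
    have hUn : B ∩ V n = ⋃ τ ∈ S, B ∩ {X | initSeg X n = τ} := by
      rw [hVS]
      ext X
      simp
    calc cantorMeasure (B ∩ V n) ≤ ∑ τ ∈ S, cantorMeasure (B ∩ {X | initSeg X n = τ}) := by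
          rw [hUn]
          exact measure_biUnion_finset_le _ _
      _ ≤ ∑ τ ∈ S, r * (2⁻¹ : ℝ≥0∞) ^ n := by
          refine Finset.sum_le_sum fun τ hτ => ?_
          have := hB τ
          rwa [cantorMeasure_initSeg_eq, hS τ hτ] at this
      _ = r * cantorMeasure (V n) := by
          rw [hVS, cantorMeasure_initSeg_mem hS, Finset.sum_const, nsmul_eq_mul]
          ring
      _ ≤ r * cantorMeasure U := by
          gcongr
          exact fun X hX => hX X rfl
  -- If `B` had positive measure, outer regularity would give an open `U ⊇ B` of measure less than
  -- `cantorMeasure B / r`, against `key`.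
  by_contra h0
  have hlt : cantorMeasure B < cantorMeasure B / r := by
    rw [ENNReal.lt_div_iff_mul_lt (.inr (measure_ne_top _ _)) (.inr h0), mul_comm]
    calc r * cantorMeasure B < 1 * cantorMeasure B := by
          exact ENNReal.mul_lt_mul_left h0 (measure_ne_top _ _) hr
      _ = cantorMeasure B := one_mul _
  obtain ⟨U, hBU, hU, hμ⟩ := Set.exists_isOpen_lt_of_lt B _ hlt
  exact absurd (key U hU hBU) (not_le.2 (ENNReal.mul_lt_of_lt_div' hμ))

/-- Random flips of components split each pair with probability one half. -/
theorem exists_flip_split {ι : Type*} (S : Finset ι) (a b : ι → ℕ) (x y : ι → Bool)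
    (hab : ∀ i ∈ S, a i ≠ b i) : ∃ flip : ℕ → Bool,
      S.card ≤ 2 * (S.filter fun i => (x i ^^ flip (a i)) ≠ (y i ^^ flip (b i))).card := by
  classical
  let N := S.sup a + S.sup b + 1
  have ha : ∀ i ∈ S, a i < N := fun i hi => by
    have := Finset.le_sup (f := a) hi
    omega
  let ext (f : Fin N → Bool) (m : ℕ) : Bool := if h : m < N then f ⟨m, h⟩ else false
  let R (f : Fin N → Bool) (i : ι) : Prop := (x i ^^ ext f (a i)) ≠ (y i ^^ ext f (b i))
  have hhalf : ∀ i ∈ S, 2 * (Finset.univ.filter fun f => R f i).card =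
      Fintype.card (Fin N → Bool) := by
    intro i hi
    -- Toggling the flip of `a i` leaves that of `b i` alone, so this involution exchanges the flips
    -- that split the pair with those that do not.
    let φ (f : Fin N → Bool) : Fin N → Bool :=
      Function.update f ⟨a i, ha i hi⟩ (!f ⟨a i, ha i hi⟩)
    have hφ : Function.Involutive φ := by
      intro f
      simp [φ]
    have hRφ : ∀ f, R (φ f) i ↔ ¬ R f i := by
      intro f
      have h₁ : ext (φ f) (a i) = !ext f (a i) := by simp [ext, φ, ha i hi]
      have h₂ : ext (φ f) (b i) = ext f (b i) := by
        by_cases hb : b i < N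
        · simp [ext, φ, hb, Function.update_of_ne, (hab i hi).symm]
        · simp [ext, hb]
      simp only [R, h₁, h₂]
      cases x i <;> cases y i <;> cases ext f (a i) <;> cases ext f (b i) <;> simp
    have hcard : (Finset.univ.filter fun f => R f i).card =
        (Finset.univ.filter fun f => ¬ R f i).card :=
      Finset.card_equiv hφ.toPerm fun f => by simp [hRφ]
    rw [two_mul]
    nth_rewrite 2 [hcard]
    rw [Finset.card_filter_add_card_filter_not, Finset.card_univ]
  -- Double counting: on average over `f` half of the pairs are split, so some `f` reaches the
  -- average.
  have hsum := Finset.sum_card_bipartiteAbove_eq_sum_card_bipartiteBelow (s := Finset.univ)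
    (t := S) R
  simp only [Finset.bipartiteAbove, Finset.bipartiteBelow] at hsum
  by_contra! hno
  have hlt : ∑ f : Fin N → Bool, 2 * (S.filter fun i => R f i).card <
      ∑ f : Fin N → Bool, S.card :=
    Finset.sum_lt_sum_of_nonempty Finset.univ_nonempty fun f _ => hno (ext f)
  rw [← Finset.mul_sum, hsum, Finset.mul_sum, Finset.sum_congr rfl hhalf] at hlt
  simp [mul_comm] at hlt

end Measure

/-! ### Each requirement succeeds, and the conclusion. -/

section Main

open MeasureTheory
open scoped ENNReal
theorem ENNReal.natCast_mul_inv_two_pow_eq_ofReal (k t : ℕ) :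
    (k : ℝ≥0∞) * 2⁻¹ ^ t = ENNReal.ofReal (k / 2 ^ t) := by
  rw [ENNReal.ofReal_div_of_pos (by positivity), ENNReal.ofReal_natCast,
    ENNReal.ofReal_pow (by norm_num), ENNReal.ofReal_ofNat, ← ENNReal.inv_pow, div_eq_mul_inv]

theorem ENNReal.two_thirds_mul_inv_two_pow_eq_ofReal (m : ℕ) :
    (2 / 3 : ℝ≥0∞) * 2⁻¹ ^ m = ENNReal.ofReal (2 / 3 / 2 ^ m) := by
  rw [ENNReal.ofReal_div_of_pos (by positivity), ENNReal.ofReal_div_of_pos (by positivity),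
    ENNReal.ofReal_pow (by norm_num), ENNReal.ofReal_ofNat, ENNReal.ofReal_ofNat,
    ← ENNReal.inv_pow, div_eq_mul_inv (2 / 3)]

theorem mul_two_pow_lt_of_two_thirds_lt {m t k : ℕ}
    (h : (2 / 3 : ℝ≥0∞) * 2⁻¹ ^ m < k * 2⁻¹ ^ t) : 2 * 2 ^ t < 3 * k * 2 ^ m := by
  rw [ENNReal.natCast_mul_inv_two_pow_eq_ofReal, ENNReal.two_thirds_mul_inv_two_pow_eq_ofReal] at h
  have h := (ENNReal.ofReal_lt_ofReal_iff_of_nonneg (by positivity)).1 h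
  rw [div_div, div_lt_div_iff₀ (by positivity) (by positivity)] at h
  have : (2 : ℝ) * 2 ^ t < 3 * k * 2 ^ m := by linarith
  exact_mod_cast this

theorem inv_two_pow_le_of_le {m t k : ℕ} (h : 2 ^ t ≤ 3 * k * 2 ^ m) :
    (2⁻¹ : ℝ≥0∞) ^ m ≤ 2 / 3 * 2⁻¹ ^ m + k * 2⁻¹ ^ t := by
  have h : (2 : ℝ) ^ t ≤ 3 * k * 2 ^ m := by exact_mod_cast h
  have h1 := ENNReal.natCast_mul_inv_two_pow_eq_ofReal 1 m
  rw [Nat.cast_one, one_mul, Nat.cast_one] at h1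
  rw [ENNReal.natCast_mul_inv_two_pow_eq_ofReal, ENNReal.two_thirds_mul_inv_two_pow_eq_ofReal, h1,
    ← ENNReal.ofReal_add (by positivity) (by positivity)]
  refine ENNReal.ofReal_le_ofReal ?_
  rw [div_add_div _ _ (by positivity) (by positivity),
    div_le_div_iff₀ (by positivity) (by positivity)]
  have := mul_le_mul_of_nonneg_left h (show (0 : ℝ) ≤ 2 ^ m / 3 by positivity)
  nlinarith

/-- The oracles from which the program `e` enumerates an infinite homogeneous set. -/
def homogeneousOracles (G : SimpleGraph ℕ) (e : Code) : Set (ℕ → Bool) :=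
  {X | (enumSet e X).Infinite ∧ GraphHomogeneous G (enumSet e X)}

/-- If a third of the extensions of `σ` enumerate pairs joined by odd paths, then at most two
thirds of them enumerate homogeneous sets. -/
theorem cantorMeasure_homogeneousOracles_le_of_witness {G : SimpleGraph ℕ} {σ : List Bool}
    {e : Code} {w : ℕ × List (List Bool)} {P : List (ℕ × ℕ)} (hw : IsSplitWitness (σ, e) w P)
    (hP : ∀ p ∈ P, ∃ q : G.Walk p.1 p.2, q.IsPath ∧ Odd q.length) :
    cantorMeasure (homogeneousOracles G e ∩ {X | initSeg X σ.length = σ}) ≤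
      2 / 3 * (2⁻¹ : ℝ≥0∞) ^ σ.length := by
  obtain ⟨t, L⟩ := w
  obtain ⟨hnd, hcard, hL⟩ := hw
  have hnd := List.nodup_iff_getD.2 hnd
  simp only at hcard hL
  let C : Set (ℕ → Bool) := {X | initSeg X t ∈ L.toFinset}
  have hC : cantorMeasure C = L.length * (2⁻¹ : ℝ≥0∞) ^ t := by
    rw [cantorMeasure_initSeg_mem fun τ hτ => (hL τ (List.mem_toFinset.1 hτ)).1,
      List.toFinset_card_of_nodup hnd]
  have hsub : C ⊆ {X | initSeg X σ.length = σ} := by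
    intro X hX
    have hX : initSeg X t ∈ L := List.mem_toFinset.1 hX
    obtain ⟨-, h, -⟩ := hL _ hX
    have hle : σ.length ≤ t := by
      have := congrArg List.length h
      rw [List.length_take, length_initSeg] at this
      omega
    rwa [take_initSeg X hle] at h
  have hdiff : homogeneousOracles G e ∩ {X | initSeg X σ.length = σ} ⊆
      {X | initSeg X σ.length = σ} \ C := by
    rintro X ⟨⟨-, hX⟩, hσ⟩
    refine ⟨hσ, fun hXC => ?_⟩
    obtain ⟨-, -, p, hp, h₁, h₂⟩ := hL _ (List.mem_toFinset.1 hXC)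
    exact hX _ h₁.mem_enumSet _ h₂.mem_enumSet (hP p hp)
  refine (measure_mono hdiff).trans ?_
  rw [measure_sdiff hsub (measurableSet_initSeg_mem _ _).nullMeasurableSet (measure_ne_top _ _),
    cantorMeasure_initSeg_eq, hC]
  exact tsub_le_iff_right.2 (inv_two_pow_le_of_le hcard)

/-- The graph all of whose requirements are given by `IsSplitRequest`. -/
noncomputable abbrev splitGraph : SimpleGraph ℕ := mergeGraph IsSplitRequest

/-- The final component of `v` has number at least `v / 2`, so an infinite set meets components of
arbitrarily large number, beyond those of the vertices `≤ c`. -/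
theorem exists_unequal_components {H : Set ℕ} (hH : H.Infinite) (Q : SplitRequest → Prop) (c : ℕ) :
    ∃ u ∈ H, ∃ v ∈ H, (finalInfo Q u).1 ≠ (finalInfo Q v).1 ∧
      (∀ w ≤ c, (finalInfo Q w).1 ≠ (finalInfo Q u).1) ∧
      ∀ w ≤ c, (finalInfo Q w).1 ≠ (finalInfo Q v).1 := by
  have hbd : ∀ b : ℕ, ∃ u ∈ H, b < (finalInfo Q u).1 := by
    intro b
    obtain ⟨u, hu, hlt⟩ := hH.exists_gt (2 * b + 1)
    have := half_le_finalInfo_fst Q u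
    exact ⟨u, hu, by omega⟩
  obtain ⟨b, hb⟩ : ∃ b, ∀ w ≤ c, (finalInfo Q w).1 ≤ b :=
    ⟨(Finset.range (c + 1)).sup fun w => (finalInfo Q w).1, fun w hw =>
      Finset.le_sup (f := fun w => (finalInfo Q w).1) (Finset.mem_range.2 (Nat.lt_succ_of_le hw))⟩
  obtain ⟨u, hu, hub⟩ := hbd b
  obtain ⟨v, hv, hvu⟩ := hbd (finalInfo Q u).1
  exact ⟨u, hu, v, hv, hvu.ne, fun w hw => ((hb w hw).trans_lt hub).ne,
    fun w hw => ((hb w hw).trans_lt (hub.trans hvu)).ne⟩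

/-- Were the bound to fail, a legitimate request of `(σ, e)` would exist, so the requirement would
act; by `cantorMeasure_homogeneousOracles_le_of_witness` its action, whatever witness it used,
forces the bound. -/
theorem cantorMeasure_homogeneousOracles_inter_le (e : Code) (σ : List Bool) :
    cantorMeasure (homogeneousOracles splitGraph e ∩ {X | initSeg X σ.length = σ}) ≤
      2 / 3 * cantorMeasure {X | initSeg X σ.length = σ} := by
  classical
  rw [cantorMeasure_initSeg_eq]
  by_contra! hlt
  let rt (v : ℕ) : ℕ := (finalInfo IsSplitRequest v).1
  let c := Encodable.encode (σ, e)
  -- Final components are not computable, but they enter only this verification and not the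
  -- construction.
  let Good (t : ℕ) (τ : List Bool) (p : ℕ × ℕ) : Prop := rt p.1 ≠ rt p.2 ∧
    (∀ w ≤ c, rt w ≠ rt p.1) ∧ (∀ w ≤ c, rt w ≠ rt p.2) ∧
    HaltsWithin e t τ p.1 ∧ HaltsWithin e t τ p.2
  let M (t : ℕ) : Set (ℕ → Bool) :=
    {X | initSeg X σ.length = σ ∧ ∃ p, Good t (initSeg X t) p}
  have hMmono : Monotone M := fun s t hst X ⟨hσ, p, h₁, h₂, h₃, h₄, h₅⟩ =>
    ⟨hσ, p, h₁, h₂, h₃, h₄.mono hst, h₅.mono hst⟩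
  have hsub : homogeneousOracles splitGraph e ∩ {X | initSeg X σ.length = σ} ⊆ ⋃ t, M t := by
    rintro X ⟨⟨hinf, -⟩, hσ⟩
    obtain ⟨u, hu, v, hv, h₁, h₂, h₃⟩ := exists_unequal_components hinf IsSplitRequest c
    obtain ⟨s, hs⟩ := exists_haltsWithin_of_mem_enumSet hu
    obtain ⟨t, ht⟩ := exists_haltsWithin_of_mem_enumSet hv
    exact Set.mem_iUnion.2 ⟨max s t, hσ, (u, v), h₁, h₂, h₃, hs.mono (le_max_left _ _),
      ht.mono (le_max_right _ _)⟩
  have hlt' := hlt.trans_le (measure_mono hsub)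
  rw [hMmono.measure_iUnion] at hlt'
  obtain ⟨s, hs⟩ := lt_iSup_iff.1 hlt'
  -- Levels below the length of `σ` are skipped so that strings of length `t` can extend `σ`.
  let t := max s σ.length
  have ht := hs.trans_le (measure_mono (hMmono (le_max_left s σ.length)))
  let S : Finset (List Bool) := (List.finite_length_eq Bool t).toFinset.filter
    fun τ => τ.take σ.length = σ ∧ ∃ p, Good t τ p
  have hS : ∀ τ ∈ S, τ.length = t ∧ τ.take σ.length = σ ∧ ∃ p, Good t τ p := fun τ hτ => by
    simpa [S] using hτ
  have hMS : M t ⊆ {X | initSeg X t ∈ S} := by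
    rintro X ⟨hσ, hp⟩
    have hσ' : (initSeg X t).take σ.length = σ := by
      rw [take_initSeg X (le_max_right _ _), hσ]
    refine Finset.mem_filter.2 ⟨?_, hσ', hp⟩
    simp [length_initSeg]
  have hcard : 2 * 2 ^ t < 3 * S.card * 2 ^ σ.length := by
    refine mul_two_pow_lt_of_two_thirds_lt (ht.trans_le ((measure_mono hMS).trans_eq ?_))
    exact cantorMeasure_initSeg_mem fun τ hτ => (hS τ hτ).1
  have : ∀ τ, ∃ p, τ ∈ S → Good t τ p := fun τ => by
    by_cases hτ : τ ∈ S
    · obtain ⟨p, hp⟩ := (hS τ hτ).2.2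
      exact ⟨p, fun _ => hp⟩
    · exact ⟨(0, 0), fun h => absurd h hτ⟩
  choose p hp using this
  obtain ⟨flip, hflip⟩ := exists_flip_split S (fun τ => rt (p τ).1) (fun τ => rt (p τ).2)
    (fun τ => (finalInfo IsSplitRequest (p τ).1).2) (fun τ => (finalInfo IsSplitRequest (p τ).2).2)
    fun τ hτ => (hp τ hτ).1
  set S' := S.filter fun τ => ((finalInfo IsSplitRequest (p τ).1).2 ^^ flip (rt (p τ).1)) ≠
    ((finalInfo IsSplitRequest (p τ).2).2 ^^ flip (rt (p τ).2)) with hS'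
  have hwit : IsSplitWitness (σ, e) (t, S'.toList) (S'.toList.map p) := by
    refine ⟨List.nodup_iff_getD.1 S'.nodup_toList, ?_, fun τ hτ => ?_⟩
    · simp only [Finset.length_toList]
      -- Half of more than two thirds is more than one third.
      have := Nat.mul_le_mul_right (2 ^ σ.length) (Nat.mul_le_mul_left 3 hflip)
      nlinarith
    · have hτS := (Finset.mem_filter.1 (Finset.mem_toList.1 hτ)).1
      exact ⟨(hS τ hτS).1, (hS τ hτS).2.1, p τ, List.mem_map_of_mem hτ, (hp τ hτS).2.2.2⟩
  obtain ⟨n, P, hnP, hodd⟩ := exists_split_of_request (isSplitRequest_encode.2 hwit) flip (by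
    intro q hq
    obtain ⟨τ, hτ, rfl⟩ := List.mem_map.1 hq
    have hτ := Finset.mem_filter.1 (Finset.mem_toList.1 hτ)
    exact ⟨(hp τ hτ.1).2.1, (hp τ hτ.1).2.2.1, hτ.2⟩)
  have hnP' : IsSplitWitness (σ, e) ((Encodable.decode n).getD (0, [])) P := by
    have : IsSplitWitness ((Encodable.decode c).getD ([], Code.zero))
      ((Encodable.decode n).getD (0, [])) P := hnP
    rwa [Encodable.encodek] at this
  exact absurd hlt (not_lt.2 (cantorMeasure_homogeneousOracles_le_of_witness hnP' hodd))

theorem mainTheorem4 :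
    ∃ G : SimpleGraph ℕ, RecursiveGraph G ∧ G.IsBipartite ∧
      cantorMeasure
        {X : ℕ → Bool | ∃ H : Set ℕ, H.Infinite ∧ GraphHomogeneous G H ∧ Enumerates X H} = 0 := by
  refine ⟨splitGraph, recursiveGraph_mergeGraph primrecPred_isSplitRequest,
    isBipartite_mergeGraph _, measure_mono_null (t := ⋃ e, homogeneousOracles splitGraph e) ?_ ?_⟩
  · rintro X ⟨H, hinf, hhom, henum⟩
    obtain ⟨e, rfl⟩ := henum.exists_code
    exact Set.mem_iUnion.2 ⟨e, hinf, hhom⟩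
  · refine measure_iUnion_null fun e => cantorMeasure_eq_zero_of_forall_le (r := 2 / 3) ?_
      (cantorMeasure_homogeneousOracles_inter_le e)
    refine ENNReal.div_lt_of_lt_mul ?_
    norm_num

end Main
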